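/- Let $K$ be any field, let $d \geq 0$, and let $R = K[x_1,\ldots,x_d]$. For $m \geq 0$ let $D^m_{R|\mathbb{Z}} \subseteq \operatorname{Hom}_{\mathbb{Z}}(R,R)$ be the module of $\mathbb{Z}$-linear differential operators on $R$ of order at most $m$, defined inductively by $D^0_{R|\mathbb{Z}} = \operatorname{Hom}_R(R,R)$ and, for $m \geq 1$, $D^m_{R|\mathbb{Z}} = \{\partial \in \operatorname{Hom}_{\mathbb{Z}}(R,R) \mid \partial\circ\mu_r - \mu_r\circ\partial \in D^{m-1}_{R|\mathbb{Z}} \text{ for all } r \in R\}$, where $\mu_r$ denotes multiplication by $r$. Then for every prime ideal $Q$ of $R$ and every $n \geq 1$, the $n$th symbolic power $Q^{(n)} = Q^nR_Q \cap R$ (the preimage of $Q^nR_Q$ under $R \to R_Q$) satisfies \[ Q^{(n)} = \{ f \in R \mid \partial(f) \in Q \text{ for all } \partial \in D^{n-1}_{R|\mathbb{Z}} \}. \] -/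

import Mathlib

/-- The set of elements of `R` that lie in no minimal prime of the ideal `I`. -/
def minimalPrimesCompl {R : Type*} [CommRing R] (I : Ideal R) : Submonoid R where
  carrier := {r | ∀ P ∈ I.minimalPrimes, r ∉ P}
  one_mem' := fun P hP h => hP.1.1.ne_top ((Ideal.eq_top_iff_one P).2 h)
  mul_mem' := fun ha hb P hP h =>
    (hP.1.1.mem_or_mem h).elim (ha P hP) (hb P hP)

/-- The `n`-th symbolic power `I ^ (n) = I ^ n R_W ∩ R`, where `W` is the complement of the
union of the minimal primes of `I`. For a prime `Q`, `W = R \ Q` and `R_W = R_Q`. -/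
noncomputable def symbolicPower {R : Type*} [CommRing R] (I : Ideal R) (n : ℕ) : Ideal R :=
  ((I ^ n).map (algebraMap R (Localization (minimalPrimesCompl I)))).comap
    (algebraMap R (Localization (minimalPrimesCompl I)))

/-- The `R`-module `D^n_{R|A}` of `A`-linear differential operators on `R` of order at most `n`:
`D^0` is `Hom_R(R, R)`, and `∂` lies in `D^(n+1)` if and only if the commutator of `∂` with
multiplication by `r` lies in `D^n` for every `r : R`. -/
noncomputable def diffOp (A R : Type*) [CommRing A] [CommRing R] [Algebra A R] :
    ℕ → Submodule R (R →ₗ[A] R)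
  | 0 => LinearMap.range (LinearMap.restrictScalarsₗ A R R R R)
  | n + 1 =>
    { carrier := {D | ∀ r : R,
        D ∘ₗ LinearMap.mulLeft A r - LinearMap.mulLeft A r ∘ₗ D ∈ diffOp A R n}
      zero_mem' := fun r => by simp
      add_mem' := fun {D E} hD hE r => by
        convert (diffOp A R n).add_mem (hD r) (hE r) using 1
        ext x
        simp only [LinearMap.sub_apply, LinearMap.add_apply, LinearMap.comp_apply,
          LinearMap.mulLeft_apply]
        ring
      smul_mem' := fun c D hD r => by
        convert (diffOp A R n).smul_mem c (hD r) using 1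
        ext x
        simp only [LinearMap.sub_apply, LinearMap.smul_apply, LinearMap.comp_apply,
          LinearMap.mulLeft_apply, smul_eq_mul]
        ring }

/-- The `n`-th `A`-linear differential power of the ideal `I`, for `n ≥ 1`: the set of all `f`
such that `∂ f ∈ I` for every `A`-linear differential operator `∂` of order at most `n - 1`. -/
def differentialPower (A : Type*) {R : Type*} [CommRing A] [CommRing R] [Algebra A R]
    (I : Ideal R) (n : ℕ) : Set R :=
  {f | ∀ D ∈ diffOp A R (n - 1), D f ∈ I}

/-! An operator of order less than `n` maps `Q ^ n` into `Q`, and primality of `Q` absorbs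
denominators; this gives one inclusion.

For the other, let `A = R_Q / 𝔪 ^ n`, with `φ : R → A` the canonical map. A coefficient field of `A`
gives `ψ : R → A` with `ψ ≡ φ` mod the nilpotent `𝔪` and `ψ Q = 0`. Lift both to `Φ, Ψ : R → A[x]`,
still congruent modulo a nilpotent ideal, where `Φ` extends `ψ|K` coefficientwise and `Ψ` is a
Taylor shift. Expanding `Ψ f` in a `K`-basis `e j` of `A` gives `Ψ f = ∑ e j * Φ (D j f)` with each
`D j` of order less than `n`. Evaluating at `ψ x` yields `φ f = ∑ e j * ψ (D j f)`, which vanishes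
when every `D j f` is in `Q`. -/

theorem mem_symbolicPower_iff_exists_minimalPrimesCompl {R : Type*} [CommRing R] (I : Ideal R) (n : ℕ) (f : R) :
    f ∈ symbolicPower I n ↔ ∃ s ∈ minimalPrimesCompl I, s * f ∈ I ^ n :=
  IsLocalization.algebraMap_mem_map_algebraMap_iff (minimalPrimesCompl I) _ _ _

theorem mem_symbolicPower_iff {R : Type*} [CommRing R] (Q : Ideal R) [Q.IsPrime] (n : ℕ) (f : R) :
    f ∈ symbolicPower Q n ↔ ∃ s ∉ Q, s * f ∈ Q ^ n := by
  rw [mem_symbolicPower_iff_exists_minimalPrimesCompl]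
  refine exists_congr fun s => and_congr_left fun _ => ?_
  change (∀ P ∈ Q.minimalPrimes, s ∉ P) ↔ _
  simp [Ideal.minimalPrimes_eq_subsingleton_self]

/-! ### Differential operators and powers of ideals -/

section DifferentialOperators

variable {A R : Type*} [CommRing A] [CommRing R] [Algebra A R]

theorem diffOp_zero_apply {D : R →ₗ[A] R} (hD : D ∈ diffOp A R 0) (f : R) : D f = f * D 1 := by
  obtain ⟨E, rfl⟩ := hD
  simpa using E.map_smul f 1

theorem apply_mem_of_mem_pow (I : Ideal R) (k : ℕ) (D : R →ₗ[A] R) (hD : D ∈ diffOp A R k)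
    {f : R} (hf : f ∈ I ^ (k + 1)) : D f ∈ I := by
  induction k generalizing D f with
  | zero =>
    rw [diffOp_zero_apply hD]
    exact I.mul_mem_right _ (by simpa using hf)
  | succ k ih =>
    rw [pow_succ'] at hf
    induction hf using Submodule.mul_induction_on' with
    | mem_mul_mem r hr g hg =>
      have h := ih _ (hD r) hg
      have e : D (r * g) =
          (D ∘ₗ LinearMap.mulLeft A r - LinearMap.mulLeft A r ∘ₗ D) g + r * D g := by simp
      rw [e]
      exact I.add_mem h (I.mul_mem_right _ hr)
    | add x _ y _ hx hy => rw [map_add]; exact I.add_mem hx hy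

/-- Since `s * D f = D (s * f) - [D, s] f` and `[D, s]` has lower order, induction puts `s * D f` in
`Q`, and primality cancels `s`. -/
theorem apply_mem_of_mul_mem_pow (Q : Ideal R) [Q.IsPrime] {s : R} (hs : s ∉ Q) (k : ℕ)
    (D : R →ₗ[A] R) (hD : D ∈ diffOp A R k) {f : R} (hf : s * f ∈ Q ^ (k + 1)) : D f ∈ Q := by
  have h := apply_mem_of_mem_pow Q k D hD hf
  refine (Ideal.IsPrime.mem_or_mem ‹_› (?_ : s * D f ∈ Q)).resolve_left hs
  induction k generalizing D with
  | zero =>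
    rw [diffOp_zero_apply hD] at h ⊢
    rwa [mul_assoc] at h
  | succ k ih =>
    have hf' : s * f ∈ Q ^ (k + 1) := Ideal.pow_le_pow_right (Nat.le_succ _) hf
    have h1 := (Ideal.IsPrime.mem_or_mem ‹_› (ih _ (hD s) hf'
      (apply_mem_of_mem_pow Q k _ (hD s) hf'))).resolve_left hs
    have e : s * D f = D (s * f) -
        (D ∘ₗ LinearMap.mulLeft A s - LinearMap.mulLeft A s ∘ₗ D) f := by simp
    rw [e]
    exact Q.sub_mem h h1

theorem symbolicPower_subset_differentialPower (A : Type*) [CommRing A] [Algebra A R] (Q : Ideal R)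
    [Q.IsPrime] {n : ℕ} (hn : 1 ≤ n) :
    (symbolicPower Q n : Set R) ⊆ differentialPower A Q n := by
  intro f hf D hD
  obtain ⟨s, hs, h⟩ := (mem_symbolicPower_iff Q n f).1 hf
  exact apply_mem_of_mul_mem_pow Q hs (n - 1) D hD (by rwa [Nat.sub_add_cancel hn])

/-- If two ring homomorphisms agree modulo `J` and `J ^ n = 0`, then composing one of them with a
map that is linear with respect to the other yields differential operators of order less
than `n`. -/
theorem comp_mulLeft_comp_mem_diffOp {R B : Type*} [CommRing R] [CommRing B] (Φ Ψ : R →+* B)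
    (J : Ideal B) {n : ℕ} (hJ : J ^ n = ⊥) (hΦΨ : ∀ r, Ψ r - Φ r ∈ J) (Λ : B →ₗ[ℤ] R)
    (hΛ : ∀ r b, Λ (Φ r * b) = r * Λ b) (k i : ℕ) (hki : i + k + 1 = n) (b : B) (hb : b ∈ J ^ i) :
    Λ ∘ₗ LinearMap.mulLeft ℤ b ∘ₗ Ψ.toIntAlgHom.toLinearMap ∈ diffOp ℤ R k := by
  induction k generalizing i b with
  | zero =>
    refine ⟨LinearMap.mulRight R (Λ b), ?_⟩
    ext f
    have h : b * (Ψ f - Φ f) = 0 := by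
      have := Ideal.mul_mem_mul hb (hΦΨ f)
      rwa [← pow_succ, show i + 1 = n by omega, hJ] at this
    rw [mul_sub, sub_eq_zero] at h
    change f * Λ b = Λ (b * Ψ f)
    rw [h, mul_comm b, hΛ]
  | succ k ih =>
    intro r
    -- Commuting with `r` multiplies `b` by `Ψ r - Φ r ∈ J`: each drop in order gains a factor of
    -- `J`, until `J ^ n = 0` forces linearity.
    convert ih (i + 1) (by omega) (b * (Ψ r - Φ r))
      (by rw [pow_succ]; exact Ideal.mul_mem_mul hb (hΦΨ r)) using 1
    ext f
    change Λ (b * Ψ (r * f)) - r * Λ (b * Ψ f) = Λ (b * (Ψ r - Φ r) * Ψ f)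
    rw [← hΛ, ← map_sub, map_mul]
    congr 1
    ring

end DifferentialOperators

/-! ### Expansion in a basis of the coefficient ring -/

section CoefficientwiseExtension

variable {σ K A : Type*} [CommRing K] [CommRing A]

/-- The coefficientwise extension of an additive map to multivariate polynomials. -/
noncomputable def mapCoeff (σ : Type*) (l : A →+ K) : MvPolynomial σ A →+ MvPolynomial σ K where
  toFun := AddMonoidAlgebra.map l
  map_zero' := by ext; simp [MvPolynomial.coeff]
  map_add' p q := by ext; simp [MvPolynomial.coeff]

@[simp]
theorem coeff_mapCoeff (l : A →+ K) (p : MvPolynomial σ A) (m : σ →₀ ℕ) :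
    (mapCoeff σ l p).coeff m = l (p.coeff m) := rfl

theorem mapCoeff_map_mul (τ : K →+* A) (l : A →+ K) (hl : ∀ c a, l (τ c * a) = c * l a)
    (r : MvPolynomial σ K) (b : MvPolynomial σ A) :
    mapCoeff σ l (MvPolynomial.map τ r * b) = r * mapCoeff σ l b := by
  classical
  ext m
  simp [MvPolynomial.coeff_mul, MvPolynomial.coeff_map, hl]

end CoefficientwiseExtension

/-- Two homomorphisms `φ`, `ψ` from a polynomial ring that agree modulo a nilpotent ideal: an
element all of whose images under differential operators lie in `ker ψ` lies in `ker φ`. -/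
theorem eq_zero_of_forall_diffOp {σ K A : Type*} [Field K] [CommRing A] (m : Ideal A) {n : ℕ}
    (hn : 1 ≤ n) (hm : m ^ n = ⊥) (φ ψ : MvPolynomial σ K →+* A) (h : ∀ r, φ r - ψ r ∈ m)
    (f : MvPolynomial σ K) (hf : ∀ D ∈ diffOp ℤ (MvPolynomial σ K) (n - 1), ψ (D f) = 0) :
    φ f = 0 := by
  classical
  let τ : K →+* A := ψ.comp MvPolynomial.C
  let ρ : K →+* A := φ.comp MvPolynomial.C
  let Φ : MvPolynomial σ K →+* MvPolynomial σ A := MvPolynomial.map τ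
  let Ψ : MvPolynomial σ K →+* MvPolynomial σ A := MvPolynomial.eval₂Hom (MvPolynomial.C.comp ρ)
    fun i => MvPolynomial.X i + MvPolynomial.C (φ (.X i) - ψ (.X i))
  let J : Ideal (MvPolynomial σ A) := m.map MvPolynomial.C
  have hJ : J ^ n = ⊥ := by rw [← Ideal.map_pow, hm, Ideal.map_bot]
  have hΦΨ : ∀ r, Ψ r - Φ r ∈ J := by
    have : (Ideal.Quotient.mk J).comp Ψ = (Ideal.Quotient.mk J).comp Φ := by
      apply MvPolynomial.ringHom_ext
      · intro c
        simp only [RingHom.comp_apply, Ψ, Φ, MvPolynomial.coe_eval₂Hom, MvPolynomial.eval₂_C,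
          MvPolynomial.map_C]
        rw [Ideal.Quotient.eq, ← map_sub]
        exact Ideal.mem_map_of_mem _ (h _)
      · intro i
        simp only [RingHom.comp_apply, Ψ, Φ, MvPolynomial.coe_eval₂Hom, MvPolynomial.eval₂_X,
          MvPolynomial.map_X]
        rw [Ideal.Quotient.eq, add_sub_cancel_left]
        exact Ideal.mem_map_of_mem _ (h _)
    intro r
    exact Ideal.Quotient.eq.1 (congrArg (fun g => g r) this)
  let ev : MvPolynomial σ A →+* A := MvPolynomial.eval fun i => ψ (.X i)
  have hevΨ : ev.comp Ψ = φ := by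
    apply MvPolynomial.ringHom_ext
    · intro c; simp [ev, Ψ, ρ]
    · intro i; simp [ev, Ψ]
  have hevΦ : ev.comp Φ = ψ := by
    apply MvPolynomial.ringHom_ext
    · intro c; simp [ev, Φ, τ]
    · intro i; simp [ev, Φ]
  -- The scalars act through `τ`, not `ρ`, so that the extended coordinate maps are linear along
  -- `Φ`.
  let : Algebra K A := τ.toAlgebra
  let e := Module.Basis.ofVectorSpace K A
  let l (j) : A →+ K := (e.coord j).toAddMonoidHom
  have hl (j) (c : K) (a : A) : l j (τ c * a) = c * l j a := (e.coord j).map_smul c a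
  have hD (j) : ψ (mapCoeff σ (l j) (Ψ f)) = 0 := by
    have := hf _ (comp_mulLeft_comp_mem_diffOp Φ Ψ J hJ hΦΨ (mapCoeff σ (l j)).toIntLinearMap
      (mapCoeff_map_mul τ (l j) (hl j)) (n - 1) 0 (by omega) 1 (by simp))
    simpa using this
  let s := (Ψ f).support.biUnion fun m => (e.repr ((Ψ f).coeff m)).support
  have hs : Ψ f = ∑ j ∈ s, MvPolynomial.C (e j) * Φ (mapCoeff σ (l j) (Ψ f)) := by
    ext m
    rw [MvPolynomial.coeff_sum]
    simp only [MvPolynomial.coeff_C_mul, Φ, MvPolynomial.coeff_map, coeff_mapCoeff]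
    have hsub : (e.repr ((Ψ f).coeff m)).support ⊆ s := by
      by_cases hm : m ∈ (Ψ f).support
      · exact Finset.subset_biUnion_of_mem (fun m => (e.repr ((Ψ f).coeff m)).support) hm
      · rw [MvPolynomial.notMem_support_iff.1 hm]; simp
    conv_lhs => rw [← e.linearCombination_repr ((Ψ f).coeff m)]
    rw [Finsupp.linearCombination_apply, Finsupp.sum_of_support_subset _ hsub _ (by simp)]
    exact Finset.sum_congr rfl fun j _ => mul_comm (τ _) (e j)
  rw [← hevΨ, RingHom.comp_apply, hs, map_sum]
  refine Finset.sum_eq_zero fun j _ => ?_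
  rw [map_mul, ← RingHom.comp_apply ev Φ, hevΦ, hD, mul_zero]

/-! ### Existence of coefficient fields -/

section CoefficientField

/-- `X ^ p - b` has no root in `S`, hence is irreducible and is the minimal polynomial of `π a`; it
already kills `a`, so `π` is injective on `S[a]`. -/
theorem eq_zero_of_mem_adjoin_pth_root {S A κ : Type*} [Field S] [CommRing A] [Field κ]
    [Algebra S A] (p : ℕ) [Fact p.Prime] [CharP κ p] (π : A →+* κ) (a : A) (b : S)
    (hab : a ^ p = algebraMap S A b) (ha : ∀ c : S, π (algebraMap S A c) ≠ π a) (y : A)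
    (hy : y ∈ Algebra.adjoin S {a}) (hπ : π y = 0) : y = 0 := by
  let : Algebra S κ := (π.comp (algebraMap S A)).toAlgebra
  let πS : A →ₐ[S] κ := { π with commutes' := fun _ => rfl }
  rw [Algebra.adjoin_singleton_eq_range_aeval] at hy
  obtain ⟨q, rfl⟩ := hy
  have hirr : Irreducible (Polynomial.X ^ p - Polynomial.C b) := by
    refine X_pow_sub_C_irreducible_of_prime (Fact.out : p.Prime) fun c hc => ha c ?_
    apply frobenius_inj κ p
    rw [frobenius_def, frobenius_def, ← map_pow, ← map_pow, ← map_pow, hc, hab]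
  have hmin : Polynomial.X ^ p - Polynomial.C b = minpoly S (π a) := by
    refine minpoly.eq_of_irreducible_of_monic hirr ?_
      (Polynomial.monic_X_pow_sub_C _ (Fact.out : p.Prime).ne_zero)
    have : Polynomial.aeval (πS a) (Polynomial.X ^ p - Polynomial.C b) = 0 := by
      rw [Polynomial.aeval_algHom_apply]
      simp [hab]
    exact this
  have hdvd : minpoly S (π a) ∣ q := by
    apply minpoly.dvd
    have : Polynomial.aeval (πS a) q = 0 := by
      rw [Polynomial.aeval_algHom_apply]; exact hπ
    exact this
  rw [← hmin] at hdvd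
  obtain ⟨g, rfl⟩ := hdvd
  simp [hab]

/-- In prime characteristic, a square-zero extension of a field contains a coefficient field. -/
theorem exists_section_of_ker_sq_eq_bot {A κ : Type*} [CommRing A] [Field κ] (p : ℕ)
    [Fact p.Prime] [CharP A p] [CharP κ p] (π : A →+* κ) (hπ : Function.Surjective π)
    (hker : RingHom.ker π ^ 2 = ⊥) : ∃ g : κ →+* A, π.comp g = RingHom.id κ := by
  have hp : p.Prime := Fact.out
  have hpow : ∀ x, π x = 0 → x ^ p = 0 := by
    intro x hx
    have : x ^ 2 = 0 := by
      have := Ideal.pow_mem_pow (show x ∈ RingHom.ker π from hx) 2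
      rwa [hker] at this
    exact pow_eq_zero_of_le hp.two_le this
  -- Containing all `p`-th powers makes each such subring a field; a maximal one surjects onto `κ`,
  -- since otherwise a `p`-th root could be adjoined.
  let 𝒮 : Set (Subring A) := {S | (∀ x, x ^ p ∈ S) ∧ ∀ y ∈ S, π y = 0 → y = 0}
  obtain ⟨S, -, hS⟩ : ∃ S, (frobenius A p).range ≤ S ∧ Maximal (· ∈ 𝒮) S := by
    refine zorn_le_nonempty₀ 𝒮 (fun c hc hchain T hT => ⟨sSup c, ⟨?_, ?_⟩, fun z hz => le_sSup hz⟩)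
      _ ⟨fun x => ⟨x, rfl⟩, ?_⟩
    · exact fun x => le_sSup hT ((hc hT).1 x)
    · intro y hy hy0
      obtain ⟨T', hT', hyT'⟩ := (Subring.mem_sSup_of_directedOn ⟨T, hT⟩ hchain.directedOn).1 hy
      exact (hc hT').2 y hyT' hy0
    · rintro _ ⟨x, rfl⟩ hx
      rw [frobenius_def, map_pow] at hx
      exact hpow x (eq_zero_of_pow_eq_zero hx)
  have : Nontrivial A := π.domain_nontrivial
  have hfield : IsField S := by
    refine ⟨⟨0, 1, zero_ne_one⟩, mul_comm, fun {a} ha => ?_⟩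
    have hπa : π a ≠ 0 := fun h => ha (Subtype.ext (hS.prop.2 a a.2 h))
    obtain ⟨t, ht⟩ := hπ (π a)⁻¹
    -- Modulo the kernel `a * t` is `1`, so `(a * t) ^ p = 1` exactly.
    refine ⟨⟨a ^ (p - 1) * t ^ p, S.mul_mem (S.pow_mem a.2 _) (hS.prop.1 t)⟩, Subtype.ext ?_⟩
    change (a : A) * ((a : A) ^ (p - 1) * t ^ p) = 1
    rw [← mul_assoc, ← pow_succ', Nat.sub_add_cancel hp.one_le, ← mul_pow, ← sub_eq_zero]
    have : (a * t : A) ^ p - 1 = (a * t - 1) ^ p := by rw [sub_pow_char, one_pow]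
    rw [this]
    exact hpow _ (by simp [ht, hπa])
  have hsurj : Function.Surjective (π.comp S.subtype) := by
    intro y
    obtain ⟨a, rfl⟩ := hπ y
    by_contra! hne
    let : Field S := hfield.toField
    have key := eq_zero_of_mem_adjoin_pth_root (S := S) p π a ⟨a ^ p, hS.prop.1 a⟩ rfl hne
    have hle : S ≤ (Algebra.adjoin S {a}).toSubring := fun x hx =>
      (Algebra.adjoin S {a}).algebraMap_mem ⟨x, hx⟩
    have haS : a ∈ S := hS.le_of_ge (y := (Algebra.adjoin S {a}).toSubring)
      ⟨fun x => hle (hS.prop.1 x), key⟩ hle (Algebra.self_mem_adjoin_singleton S a)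
    exact hne ⟨a, haS⟩ rfl
  have hinj : Function.Injective (π.comp S.subtype) :=
    (injective_iff_map_eq_zero _).2 fun a ha => Subtype.ext (hS.prop.2 a a.2 ha)
  let E := RingEquiv.ofBijective _ ⟨hinj, hsurj⟩
  exact ⟨S.subtype.comp E.symm.toRingHom, RingHom.ext fun x => E.apply_symm_apply x⟩

/-- For a polynomial presentation of `κ` with kernel `I`, it suffices to split the quotient by `I ^
2`, a square-zero extension of `κ`. -/
theorem formallySmooth_zmod_field (p : ℕ) [Fact p.Prime] (κ : Type*) [Field κ]
    [Algebra (ZMod p) κ] : Algebra.FormallySmooth (ZMod p) κ := by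
  have : CharP κ p := charP_of_injective_algebraMap (algebraMap (ZMod p) κ).injective p
  let f : MvPolynomial κ (ZMod p) →ₐ[ZMod p] κ := MvPolynomial.aeval id
  have hf : Function.Surjective f := fun x => ⟨.X x, by simp [f]⟩
  have hker : RingHom.ker f.kerSquareLift.toRingHom ^ 2 = ⊥ := by
    rw [AlgHom.ker_kerSquareLift, Ideal.cotangentIdeal_square]
  have hsurj : Function.Surjective f.kerSquareLift.toRingHom :=
    Ideal.Quotient.lift_surjective_of_surjective _ _ hf
  have : Nontrivial (MvPolynomial κ (ZMod p) ⧸ RingHom.ker f.toRingHom ^ 2) :=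
    f.kerSquareLift.toRingHom.domain_nontrivial
  have : CharP (MvPolynomial κ (ZMod p) ⧸ RingHom.ker f.toRingHom ^ 2) p :=
    charP_of_injective_algebraMap (algebraMap (ZMod p) _).injective p
  obtain ⟨g, hg⟩ := exists_section_of_ker_sq_eq_bot p f.kerSquareLift.toRingHom hsurj hker
  refine .of_split f { g with commutes' := fun c => ?_ } (AlgHom.ext fun x => RingHom.congr_fun hg x)
  exact RingHom.congr_fun
    (Subsingleton.elim (g.comp (algebraMap (ZMod p) κ)) (algebraMap (ZMod p) _)) c

theorem formallySmooth_field_of_charZero (k κ : Type*) [Field k] [CharZero k] [Field κ]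
    [Algebra k κ] : Algebra.FormallySmooth k κ := by
  obtain ⟨s, hs⟩ := exists_isTranscendenceBasis k κ
  have := hs.isAlgebraic_field
  have : CharZero (IntermediateField.adjoin k (Set.range ((↑) : s → κ))) :=
    charZero_of_injective_algebraMap (algebraMap k _).injective
  exact .of_algebraicIndependent_of_isSeparable hs.1

/-- A nilpotent extension of a field by an algebra over some field contains a coefficient
field. -/
theorem exists_section_of_isNilpotent_ker {K A κ : Type*} [Field K] [CommRing A] [Field κ]
    (ρ : K →+* A) (π : A →+* κ) (hπ : Function.Surjective π) (hker : IsNilpotent (RingHom.ker π)) :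
    ∃ g : κ →+* A, π.comp g = RingHom.id κ := by
  -- Here `k` is the prime field of `K`: every field over it is formally smooth, so the identity of
  -- `κ` lifts through `π`.
  suffices h : ∃ (k : Type) (_ : Field k) (_ : k →+* K),
      ∀ [Algebra k κ], Algebra.FormallySmooth k κ by
    obtain ⟨k, _, i, h⟩ := h
    let : Algebra k A := (ρ.comp i).toAlgebra
    let : Algebra k κ := (π.comp (ρ.comp i)).toAlgebra
    let πk : A →ₐ[k] κ := { π with commutes' := fun _ => rfl }
    have := h
    exact ⟨(Algebra.FormallySmooth.liftOfSurjective (AlgHom.id k κ) πk hπ hker).toRingHom,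
      RingHom.ext fun x =>
        Algebra.FormallySmooth.liftOfSurjective_apply (AlgHom.id k κ) πk hπ hker x⟩
  obtain ⟨p, hp⟩ := CharP.exists K
  rcases CharP.char_is_prime_or_zero K p with h | rfl
  · have : Fact p.Prime := ⟨h⟩
    exact ⟨ZMod p, inferInstance, ZMod.castHom dvd_rfl K, formallySmooth_zmod_field p κ⟩
  · have := CharP.charP_to_charZero K
    exact ⟨ℚ, inferInstance, algebraMap ℚ K, formallySmooth_field_of_charZero ℚ κ⟩

/-- The quotient of a local ring containing a field by a power of its maximal ideal contains a
coefficient field. -/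
theorem IsLocalRing.exists_hom_quotient_maximalIdeal_pow {K L : Type*} [Field K] [CommRing L]
    [IsLocalRing L] (ρ : K →+* L) {n : ℕ} (hn : 1 ≤ n) :
    ∃ g : L →+* L ⧸ maximalIdeal L ^ n, (∀ x ∈ maximalIdeal L, g x = 0) ∧
      ∀ x, Ideal.Quotient.mk _ x - g x ∈ (maximalIdeal L).map (Ideal.Quotient.mk _) := by
  have hle : maximalIdeal L ^ n ≤ maximalIdeal L := Ideal.pow_le_self (Nat.one_le_iff_ne_zero.1 hn)
  let π : L ⧸ maximalIdeal L ^ n →+* ResidueField L := Ideal.Quotient.factor hle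
  have hπ : Function.Surjective π := Ideal.Quotient.factor_surjective hle
  have hker : RingHom.ker π = (maximalIdeal L).map (Ideal.Quotient.mk _) :=
    Ideal.Quotient.factor_ker hle
  have hnil : RingHom.ker π ^ n = ⊥ := by
    rw [hker, ← Ideal.map_pow]
    exact Ideal.map_quotient_self _
  obtain ⟨g, hg⟩ := exists_section_of_isNilpotent_ker ((Ideal.Quotient.mk _).comp ρ) π hπ
    ⟨n, hnil⟩
  refine ⟨g.comp (residue L), fun x hx => ?_, fun x => ?_⟩
  · rw [RingHom.comp_apply, (residue_eq_zero_iff x).2 hx, map_zero]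
  · rw [← hker, RingHom.mem_ker, map_sub, sub_eq_zero]
    exact (RingHom.congr_fun hg (residue L x)).symm

end CoefficientField

/-! ### Comparison of differential and symbolic powers -/

theorem map_mem_pow_maximalIdeal_of_mem_differentialPower {σ K L : Type*} [Field K] [CommRing L]
    [IsLocalRing L] (φ : MvPolynomial σ K →+* L) {n : ℕ} (hn : 1 ≤ n) {f : MvPolynomial σ K}
    (hf : f ∈ differentialPower ℤ ((IsLocalRing.maximalIdeal L).comap φ) n) :
    φ f ∈ IsLocalRing.maximalIdeal L ^ n := by
  obtain ⟨g, hg, hsub⟩ :=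
    IsLocalRing.exists_hom_quotient_maximalIdeal_pow (φ.comp MvPolynomial.C) hn
  refine Ideal.Quotient.eq_zero_iff_mem.1 (eq_zero_of_forall_diffOp _ hn ?_
    ((Ideal.Quotient.mk _).comp φ) (g.comp φ) (fun r => hsub (φ r)) f fun D hD => hg _ (hf D hD))
  rw [← Ideal.map_pow]
  exact Ideal.map_quotient_self _

theorem differentialPower_subset_symbolicPower {σ K : Type*} [Field K]
    (Q : Ideal (MvPolynomial σ K)) [Q.IsPrime] {n : ℕ} (hn : 1 ≤ n) :
    differentialPower ℤ Q n ⊆ (symbolicPower Q n : Set (MvPolynomial σ K)) := by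
  intro f hf
  have h := map_mem_pow_maximalIdeal_of_mem_differentialPower
    (algebraMap _ (Localization.AtPrime Q)) hn (f := f)
    (by
      have h : (IsLocalRing.maximalIdeal (Localization.AtPrime Q)).comap (algebraMap _ _) = Q :=
        IsLocalization.AtPrime.under_maximalIdeal _ Q
      rwa [h])
  rw [← IsLocalization.AtPrime.map_eq_maximalIdeal Q (Localization.AtPrime Q), ← Ideal.map_pow,
    IsLocalization.algebraMap_mem_map_algebraMap_iff Q.primeCompl] at h
  exact (mem_symbolicPower_iff Q n f).2 h

theorem theoremA {K : Type*} [Field K] (d : ℕ) (Q : Ideal (MvPolynomial (Fin d) K))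
    (hQ : Q.IsPrime) (n : ℕ) (hn : 1 ≤ n) :
    (symbolicPower Q n : Set (MvPolynomial (Fin d) K)) = differentialPower ℤ Q n :=
  (symbolicPower_subset_differentialPower ℤ Q hn).antisymm
    (differentialPower_subset_symbolicPower Q hn)
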